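/- Let $d\ge 0$ and $n\ge 1$ be integers, let $r\in[1,\infty)$ and $\alpha\in(0,1]$, and let $\|\cdot\|$ be an arbitrary norm on $\mathbb{R}^{d+1}$ with dual norm $\|y\|_*=\sup_{\|x\|=1}\langle x,y\rangle$. For Borel probability measures $P,Q$ on $\mathbb{R}^{d+1}$ define the max-sliced Wasserstein distance $$\overline{\mathcal W}_r(P,Q)=\sup_{\gamma\in\mathbb{R}^{d+1}:\ \|\gamma\|=1}\mathcal W_r(P_\gamma,Q_\gamma),$$ where $P_\gamma$ is the pushforward of $P$ under $z\mapsto\langle z,\gamma\rangle$, and $\mathcal W_r(\mu,\nu)=\inf_{\pi}\big(\int|x-y|^r\,d\pi(x,y)\big)^{1/r}$, the infimum being over all couplings $\pi$ of $\mu$ and $\nu$, is the Wasserstein distance of order $r$ on $\mathbb{R}$. Let $P$ be a Borel probability measure on $\mathbb{R}^{d+1}$ with compact support, let $Z_1,\dots,Z_n$ be independent random vectors with law $P$, and let $P_n=\frac1n\sum_{i=1}^n\delta_{Z_i}$ be their empirical distribution. Then, with probability at least $1-\alpha$, $$\overline{\mathcal W}_r(P_n,P)^r\le\frac{C}{\sqrt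 n},\qquad C=\Big(180\sqrt{d+2}+\sqrt{2\log(1/\alpha)}\Big)\,\operatorname{diam}(\operatorname{supp}P)^r,$$ where $\operatorname{diam}(\operatorname{supp}P)=\sup\{\|x-\tilde x\|_*:\ x,\tilde x\in\operatorname{supp}P\}$. -/

import Mathlib

open MeasureTheory ProbabilityTheory
open scoped ENNReal Matrix

noncomputable section

/-- The set `Π(μ, ν)` of couplings of two measures on the real line: the measures on `ℝ × ℝ`
whose first marginal is `μ` and whose second marginal is `ν`. -/
def couplings (μ ν : Measure ℝ) : Set (Measure (ℝ × ℝ)) :=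
  {π | π.map Prod.fst = μ ∧ π.map Prod.snd = ν}

/-- The one-dimensional Wasserstein distance of order `r`, with values in `[0, ∞]`:
`W_r(μ, ν) = inf_{π ∈ Π(μ, ν)} (∫ |x - y|^r dπ(x, y))^{1/r}`. -/
def wasserstein (r : ℝ) (μ ν : Measure ℝ) : ℝ≥0∞ :=
  ⨅ π ∈ couplings μ ν, (∫⁻ p, ENNReal.ofReal (|p.1 - p.2| ^ r) ∂π) ^ (1 / r)

/-- The law of the scalar `z ⬝ᵥ γ` when `z` has law `P`: the pushforward of `P` under the
linear functional `z ↦ z ⬝ᵥ γ`. -/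
def proj {m : ℕ} (γ : Fin m → ℝ) (P : Measure (Fin m → ℝ)) : Measure ℝ :=
  P.map (fun z => z ⬝ᵥ γ)

/-- The max-sliced Wasserstein distance of order `r` on `(ℝ^m, N)`: the supremum, over the unit
sphere of `N`, of the Wasserstein distances of the one-dimensional projections. -/
def maxSlicedWasserstein {m : ℕ} (N : Seminorm ℝ (Fin m → ℝ)) (r : ℝ)
    (P Q : Measure (Fin m → ℝ)) : ℝ≥0∞ :=
  ⨆ γ ∈ {γ : Fin m → ℝ | N γ = 1}, wasserstein r (proj γ P) (proj γ Q)

/-- The dual norm `‖y‖_* = sup {⟨x, y⟩ : N x = 1}`. (The set is nonempty and bounded above when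
`N` is a norm and `m ≥ 1`.) -/
def dualNorm {m : ℕ} (N : Seminorm ℝ (Fin m → ℝ)) (y : Fin m → ℝ) : ℝ :=
  sSup {t : ℝ | ∃ x : Fin m → ℝ, N x = 1 ∧ t = x ⬝ᵥ y}

/-- The diameter of a set measured in the dual norm of `N`. (The set of distances is nonempty and
bounded above when `N` is a norm, `m ≥ 1`, and `S` is nonempty and bounded.) -/
def dualDiam {m : ℕ} (N : Seminorm ℝ (Fin m → ℝ)) (S : Set (Fin m → ℝ)) : ℝ :=
  sSup {t : ℝ | ∃ x ∈ S, ∃ y ∈ S, t = dualNorm N (x - y)}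

/-- The empirical distribution `(1/n) ∑ i, δ_{z i}` of a sample of size `n ≥ 1`. -/
def empirical {m n : ℕ} (z : Fin n → Fin m → ℝ) : Measure (Fin m → ℝ) :=
  (n : ℝ≥0∞)⁻¹ • ∑ i, Measure.dirac (z i)

end

/-! On an interval of length `D` one has `|x - y| ^ r ≤ D ^ (r - 1) * |x - y|`, so the quantile
coupling bounds `W_r ^ r` by `D ^ (r - 1) ∫ |F - G|`, and this integral is attained by a 1-Lipschitz
test function (`wasserstein_rpow_le`). In every direction `γ` of the unit sphere the support
projects into an interval of length `D`, its dual diameter. Hence it suffices to bound, uniformly in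
`γ` and `h`, the empirical process over the ridge functions `x ↦ h (⟨x - x₀, γ⟩)`.

That class is small. Resolving `γ` to accuracy `4 ^ (-j)` costs log-size of order `(d + 1) (j + 1)`,
and resolving `h` costs order `4 ^ j` (`exists_code_ridge`). Chaining with Hoeffding's inequality
then gives a sum of terms `4 ^ (-j) * 2 ^ j * √(d + 2) / √n`, a convergent geometric series
(`exists_event_forall_empiricalDeviation_le`). Codes, under which equal words force closeness, take
the place of nets: a representative of each word can be picked inside the class. -/

/-! ### Covering and coding the unit ball of a norm -/

/-- In a finite-dimensional normed space, the ball of radius `2` is covered by `5 ^ dim` balls of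
radius `1`. -/
lemma exists_finset_cover_of_norm_le_two {E : Type*} [NormedAddCommGroup E] [NormedSpace ℝ E]
    [FiniteDimensional ℝ E] :
    ∃ s : Finset E, s.card ≤ 5 ^ Module.finrank ℝ E ∧ ∀ x : E, ‖x‖ ≤ 2 → ∃ y ∈ s, ‖x - y‖ < 1 := by
  classical
  let A : Set ℕ := {k | ∃ s : Finset E, (∀ c ∈ s, ‖c‖ ≤ 2) ∧
    (∀ c ∈ s, ∀ d ∈ s, c ≠ d → 1 ≤ ‖c - d‖) ∧ s.card = k}
  have hA : BddAbove A := by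
    refine ⟨5 ^ Module.finrank ℝ E, ?_⟩
    rintro _ ⟨s, h1, h2, rfl⟩
    exact Besicovitch.card_le_of_separated s h1 h2
  have hne : A.Nonempty := ⟨0, ∅, by simp, by simp, by simp⟩
  -- A 1-separated subset of the ball of maximal cardinality is a cover: a point at distance at
  -- least 1 from all of it could be added.
  obtain ⟨s, h1, h2, h3⟩ := Nat.sSup_mem hne hA
  refine ⟨s, Besicovitch.card_le_of_separated s h1 h2, fun x hx => ?_⟩
  by_contra! hcon
  have hxs : x ∉ s := fun h => by
    have := hcon x h
    rw [sub_self, norm_zero] at this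
    linarith
  have hmem : s.card + 1 ∈ A := by
    refine ⟨insert x s, ?_, ?_, Finset.card_insert_of_notMem hxs⟩
    · intro c hc
      rcases Finset.mem_insert.1 hc with rfl | hc
      exacts [hx, h1 c hc]
    · intro c hc d hd hcd
      rcases Finset.mem_insert.1 hc with rfl | hc' <;> rcases Finset.mem_insert.1 hd with rfl | hd'
      · exact absurd rfl hcd
      · exact hcon d hd'
      · rw [norm_sub_rev]; exact hcon c hc'
      · exact h2 c hc' d hd' hcd
  have := le_csSup hA hmem
  omega

/-- A seminorm that separates points is a norm. -/
lemma Seminorm.normedSpaceCore {E : Type*} [AddCommGroup E] [Module ℝ E] (N : Seminorm ℝ E)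
    (hN : ∀ x, N x = 0 → x = 0) : @NormedSpace.Core ℝ E _ _ _ ⟨N⟩ :=
  let : Norm E := ⟨N⟩
  { norm_nonneg := fun x => apply_nonneg N x
    norm_smul := fun c x => map_smul_eq_mul N c x
    norm_triangle := fun x y => map_add_le_add N x y
    norm_eq_zero_iff := fun x => ⟨hN x, fun h => by rw [h]; exact map_zero N⟩ }

/-- The version of `exists_finset_cover_of_norm_le_two` for a seminorm that separates points. -/
lemma Seminorm.exists_finset_cover {E : Type*} [AddCommGroup E] [Module ℝ E]
    [FiniteDimensional ℝ E] (N : Seminorm ℝ E) (hN : ∀ x, N x = 0 → x = 0) :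
    ∃ s : Finset E, s.card ≤ 5 ^ Module.finrank ℝ E ∧
      ∀ x : E, N x ≤ 2 → ∃ y ∈ s, N (x - y) < 1 := by
  let : Norm E := ⟨N⟩
  let : NormedAddCommGroup E := NormedAddCommGroup.ofCore (N.normedSpaceCore hN)
  let : NormedSpace ℝ E := NormedSpace.ofCore (N.normedSpaceCore hN)
  exact exists_finset_cover_of_norm_le_two

/-- A code with `5 ^ (k * dim)` words that determines the points of the unit ball up to
`2 / 2 ^ k`. -/
lemma Seminorm.exists_code {E : Type*} [AddCommGroup E] [Module ℝ E]
    [FiniteDimensional ℝ E] (N : Seminorm ℝ E) (hN : ∀ x, N x = 0 → x = 0) (k : ℕ) :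
    ∃ s : Finset E, s.card ≤ 5 ^ Module.finrank ℝ E ∧ ∃ c : {x : E // N x ≤ 1} → (Fin k → s),
      ∀ x y, c x = c y → N (x.1 - y.1) ≤ 2 / 2 ^ k := by
  obtain ⟨s, hs, hcov⟩ := N.exists_finset_cover hN
  refine ⟨s, hs, ?_⟩
  have hp : ∀ x : {x : E // N x ≤ 2}, ∃ y : s, N (x.1 - y.1) < 1 := fun x => by
    obtain ⟨y, hy, h⟩ := hcov x.1 x.2
    exact ⟨⟨y, hy⟩, h⟩
  choose p hp using hp
  have h2 : ∀ x : E, N ((2 : ℝ) • x) = 2 * N x := fun x => by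
    rw [map_smul_eq_mul]; norm_num
  -- One step of a base-2 expansion: subtracting a centre at distance less than 1 and doubling leads
  -- back to the ball of radius 2. The letters of the code are the successive centres.
  let Y : {x : E // N x ≤ 2} → {x : E // N x ≤ 2} := fun x =>
    ⟨(2 : ℝ) • (x.1 - (p x).1), by rw [h2]; linarith [hp x]⟩
  let ini : {x : E // N x ≤ 1} → {x : E // N x ≤ 2} := fun x =>
    ⟨(2 : ℝ) • x.1, by rw [h2]; linarith [x.2]⟩
  refine ⟨fun x i => p (Y^[i] (ini x)), fun x y hxy => ?_⟩
  -- Equal centres cancel, so the difference of the two orbits doubles at each step, yet it never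
  -- exceeds 4 in norm.
  have key : ∀ m ≤ k, (Y^[m] (ini x)).1 - (Y^[m] (ini y)).1 = (2 : ℝ) ^ (m + 1) • (x.1 - y.1) := by
    intro m hm
    induction m with
    | zero => simp [ini, smul_sub]
    | succ m ih =>
      have e := congrFun hxy ⟨m, hm⟩
      simp only at e
      rw [Function.iterate_succ_apply', Function.iterate_succ_apply']
      simp only [Y]
      rw [e, ← smul_sub, sub_sub_sub_cancel_right, ih (by omega), smul_smul, ← pow_succ']
  have h := key k le_rfl
  have h4 : N ((2 : ℝ) ^ (k + 1) • (x.1 - y.1)) ≤ 4 := by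
    rw [← h]
    exact (map_sub_le_add N _ _).trans (by linarith [(Y^[k] (ini x)).2, (Y^[k] (ini y)).2])
  rw [map_smul_eq_mul, Real.norm_of_nonneg (by positivity), pow_succ] at h4
  rw [le_div_iff₀ (by positivity)]
  linarith

/-! ### Coding Lipschitz functions and ridge functions -/

/-- The `1`-Lipschitz functions on the line that vanish at `a`. -/
abbrev PinnedLipschitz (a : ℝ) : Type := {h : ℝ → ℝ // LipschitzWith 1 h ∧ h a = 0}

lemma LipschitzWith.abs_sub_le_abs_sub {h : ℝ → ℝ} (hh : LipschitzWith 1 h) (x y : ℝ) :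
    |h x - h y| ≤ |x - y| := by
  simpa [Real.dist_eq] using hh.dist_le_mul x y

/-- A code with `3 ^ m` words that determines the `1`-Lipschitz functions that vanish at `a` up to
`3 * δ` on `[a, a + m * δ]`: the increments of the rounded values on the grid of mesh `δ`. -/
lemma PinnedLipschitz.exists_code (a δ : ℝ) (hδ : 0 < δ) (m : ℕ) :
    ∃ c : PinnedLipschitz a → (Fin m → Finset.Icc (-1 : ℤ) 1),
      ∀ h g, c h = c g → ∀ t, a ≤ t → t ≤ a + m * δ → |h.1 t - g.1 t| ≤ 3 * δ := by
  let F : PinnedLipschitz a → ℕ → ℤ := fun h i => ⌊h.1 (a + i * δ) / δ⌋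
  have hF : ∀ h i, F h (i + 1) - F h i ∈ Finset.Icc (-1 : ℤ) 1 := by
    intro h i
    have hl := h.2.1.abs_sub_le_abs_sub (a + (i + 1 : ℕ) * δ) (a + i * δ)
    have e : a + ((i + 1 : ℕ) : ℝ) * δ - (a + i * δ) = δ := by push_cast; ring
    rw [e, abs_of_pos hδ, abs_le] at hl
    have e1 : h.1 (a + (i + 1 : ℕ) * δ) / δ ≤ h.1 (a + i * δ) / δ + 1 := by
      rw [← sub_le_iff_le_add', ← sub_div, div_le_one hδ]; exact hl.2
    have e2 : h.1 (a + i * δ) / δ ≤ h.1 (a + (i + 1 : ℕ) * δ) / δ + 1 := by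
      rw [← sub_le_iff_le_add', ← sub_div, div_le_one hδ]; linarith [hl.1]
    have e3 := Int.floor_le_floor e1
    have e4 := Int.floor_le_floor e2
    rw [Int.floor_add_one] at e3 e4
    simp only [F, Finset.mem_Icc]
    constructor <;> linarith
  refine ⟨fun h i => ⟨F h (i + 1) - F h i, hF h i⟩, fun h g hhg t hat htm => ?_⟩
  -- Pinning at `a` makes both rounded paths start at 0, so equal increments give equal paths.
  have hFeq : ∀ i ≤ m, F h i = F g i := by
    intro i hi
    induction i with
    | zero => simp [F, h.2.2, g.2.2]
    | succ i ih =>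
      have e := congrArg Subtype.val (congrFun hhg ⟨i, hi⟩)
      simp only at e
      have := ih (by omega)
      linarith
  have hta : 0 ≤ (t - a) / δ := div_nonneg (by linarith) hδ.le
  set i := ⌊(t - a) / δ⌋₊ with hi
  have hi1 : (i : ℝ) ≤ (t - a) / δ := Nat.floor_le hta
  have hi2 : (t - a) / δ < i + 1 := Nat.lt_floor_add_one _
  rw [le_div_iff₀ hδ] at hi1
  rw [div_lt_iff₀ hδ] at hi2
  have him : i ≤ m := by
    have : (i : ℝ) * δ ≤ m * δ := by linarith
    exact_mod_cast le_of_mul_le_mul_right this hδ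
  have hgrid : |t - (a + i * δ)| ≤ δ := by rw [abs_le]; constructor <;> linarith
  have h1 := (h.2.1.abs_sub_le_abs_sub t (a + i * δ)).trans hgrid
  have h2 := (g.2.1.abs_sub_le_abs_sub t (a + i * δ)).trans hgrid
  have h3 : |h.1 (a + i * δ) - g.1 (a + i * δ)| ≤ δ := by
    have := (Int.abs_sub_lt_one_of_floor_eq_floor (hFeq i him)).le
    rwa [← sub_div, abs_div, abs_of_pos hδ, div_le_one hδ] at this
  -- One `δ` each for moving `h` and `g` from `t` to the grid point, and one for equal floors there.
  rw [abs_le] at *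
  constructor <;> linarith [h1.1, h1.2, h2.1, h2.2, h3.1, h3.2]

/-- The ridge functions `x ↦ h (⟨x - x₀, γ⟩)`, for `γ` in the unit sphere of `N` and `h`
`1`-Lipschitz, have at scale `4 ^ (-j)` a code of log-size of order `(d + 2) 4 ^ j`. -/
lemma exists_code_ridge {d : ℕ} (N : Seminorm ℝ (Fin (d + 1) → ℝ)) (hN : ∀ x, N x = 0 → x = 0)
    {D : ℝ} (hD : 0 < D) (S : Set (Fin (d + 1) → ℝ)) (x₀ : Fin (d + 1) → ℝ)
    (hS : ∀ γ, ∀ x ∈ S, |(x - x₀) ⬝ᵥ γ| ≤ N γ * D) (j : ℕ) :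
    ∃ (T : Type) (_ : Fintype T) (c : {γ // N γ ≤ 1} × PinnedLipschitz (-D) → T),
      (Fintype.card T : ℝ) ≤ Real.exp (76 * (d + 2) * 4 ^ j) ∧
      ∀ p q, c p = c q → ∀ x ∈ S,
        |p.2.1 ((x - x₀) ⬝ᵥ p.1.1) - q.2.1 ((x - x₀) ⬝ᵥ q.1.1)| ≤ D / 8 * (1 / 4) ^ j := by
  -- The error `D / 8` splits into four parts `D / 32`: three for `h` on a grid of mesh `δ`, and one
  -- for `γ`, since `2 / 2 ^ (2 j + 6) = 4 ^ (-j) / 32`. The grid has `64 * 4 ^ j` steps because it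
  -- must cover `[-D, D]`.
  obtain ⟨s, hs, c₁, hc₁⟩ := N.exists_code hN (2 * j + 6)
  have hδ : 0 < D / 32 * (1 / 4) ^ j := by positivity
  obtain ⟨c₂, hc₂⟩ := PinnedLipschitz.exists_code (-D) _ hδ (64 * 4 ^ j)
  have h4 : (1 / 4 : ℝ) ^ j * 4 ^ j = 1 := by rw [← mul_pow]; norm_num
  refine ⟨(Fin (2 * j + 6) → s) × (Fin (64 * 4 ^ j) → Finset.Icc (-1 : ℤ) 1), inferInstance,
    fun p => (c₁ p.1, c₂ p.2), ?_, ?_⟩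
  · have hcard : Fintype.card ((Fin (2 * j + 6) → s) × (Fin (64 * 4 ^ j) → Finset.Icc (-1 : ℤ) 1))
        = s.card ^ (2 * j + 6) * 3 ^ (64 * 4 ^ j) := by
      simp
    rw [hcard]
    rw [Module.finrank_fin_fun] at hs
    have he1 : (5 : ℝ) ≤ Real.exp 2 := by
      have : Real.exp 2 = Real.exp 1 * Real.exp 1 := by rw [← Real.exp_add]; norm_num
      rw [this]; nlinarith [Real.exp_one_gt_d9]
    have e5 : (s.card : ℝ) ≤ Real.exp (2 * (d + 1)) := by
      calc (s.card : ℝ) ≤ 5 ^ (d + 1) := by exact_mod_cast hs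
        _ ≤ Real.exp 2 ^ (d + 1) := by gcongr
        _ = Real.exp (2 * (d + 1)) := by rw [← Real.exp_nat_mul]; push_cast; ring_nf
    have hj : (2 * j + 6 : ℝ) ≤ 6 * 4 ^ j := by
      have : j + 1 ≤ 4 ^ j := Nat.succ_le_of_lt (Nat.lt_pow_self (by norm_num))
      have : (j : ℝ) + 1 ≤ 4 ^ j := by exact_mod_cast this
      linarith [(Nat.cast_nonneg j : (0 : ℝ) ≤ j)]
    push_cast
    calc (s.card : ℝ) ^ (2 * j + 6) * 3 ^ (64 * 4 ^ j)
        ≤ Real.exp (2 * (d + 1)) ^ (2 * j + 6) * Real.exp 2 ^ (64 * 4 ^ j) := by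
          gcongr; linarith
      _ = Real.exp ((2 * j + 6) * (2 * (d + 1)) + 64 * 4 ^ j * 2) := by
          rw [← Real.exp_nat_mul, ← Real.exp_nat_mul, ← Real.exp_add]; push_cast; ring_nf
      -- By `hj` the exponent is at most `(12 (d + 1) + 128) 4 ^ j`, and `12 d + 140 ≤ 76 (d + 2)`.
      _ ≤ Real.exp (76 * (d + 2) * 4 ^ j) := by
          apply Real.exp_le_exp.2
          have hd : (0 : ℝ) ≤ d := Nat.cast_nonneg d
          have h4j : (0 : ℝ) < 4 ^ j := by positivity
          have := mul_le_mul_of_nonneg_right hj (by positivity : (0 : ℝ) ≤ 2 * (d + 1))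
          nlinarith [mul_nonneg hd h4j.le]
  · intro p q hpq x hx
    simp only [Prod.mk.injEq] at hpq
    have hγ := hc₁ _ _ hpq.1
    have hp := hS p.1.1 x hx
    have hpD : |(x - x₀) ⬝ᵥ p.1.1| ≤ D := hp.trans (mul_le_of_le_one_left hD.le p.1.2)
    have hpq' := hS (p.1.1 - q.1.1) x hx
    have e1 := hc₂ _ _ hpq.2 ((x - x₀) ⬝ᵥ p.1.1) (abs_le.1 hpD).1 (by
      push_cast
      have : -D + 64 * 4 ^ j * (D / 32 * (1 / 4) ^ j) = -D + 2 * D * ((1 / 4) ^ j * 4 ^ j) := by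
        ring
      rw [this, h4]
      linarith [(abs_le.1 hpD).2])
    have e2 := q.2.2.1.abs_sub_le_abs_sub ((x - x₀) ⬝ᵥ p.1.1) ((x - x₀) ⬝ᵥ q.1.1)
    rw [← dotProduct_sub] at e2
    have e3 : (2 : ℝ) / 2 ^ (2 * j + 6) = 1 / 32 * (1 / 4) ^ j := by
      rw [pow_add, pow_mul]
      norm_num
      field_simp
      linarith
    rw [e3] at hγ
    have e4 := e2.trans (hpq'.trans (mul_le_mul_of_nonneg_right hγ hD.le))
    rw [abs_le] at *
    constructor <;> linarith [e1.1, e1.2, e4.1, e4.2]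

/-! ### Hoeffding bounds and chaining for the empirical process -/

/-- The deviation of the average of `g` over the sample `z` from its mean under `P`. -/
noncomputable def empiricalDeviation {X : Type*} [MeasurableSpace X] {n : ℕ} (P : Measure X)
    (z : Fin n → X) (g : X → ℝ) : ℝ :=
  (∑ k, g (z k)) / n - ∫ x, g x ∂P

lemma integrable_of_abs_le_on {X : Type*} [MeasurableSpace X] {P : Measure X}
    [IsProbabilityMeasure P] {S : Set X} (hS : ∀ᵐ x ∂P, x ∈ S) {g : X → ℝ} (hg : Measurable g)
    {e : ℝ} (he : ∀ x ∈ S, |g x| ≤ e) : Integrable g P :=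
  Integrable.of_bound hg.aestronglyMeasurable e (by filter_upwards [hS] with x hx using he x hx)

lemma empiricalDeviation_sub {X : Type*} [MeasurableSpace X] {n : ℕ} {P : Measure X}
    (z : Fin n → X) {g h : X → ℝ} (hg : Integrable g P) (hh : Integrable h P) :
    empiricalDeviation P z (g - h) = empiricalDeviation P z g - empiricalDeviation P z h := by
  simp only [empiricalDeviation, Pi.sub_apply]
  rw [integral_sub hg hh, Finset.sum_sub_distrib, sub_div]
  ring

lemma empiricalDeviation_le_two_mul {X : Type*} [MeasurableSpace X] {n : ℕ} (hn : 1 ≤ n)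
    {P : Measure X} [IsProbabilityMeasure P] {S : Set X} (hS : ∀ᵐ x ∂P, x ∈ S) {z : Fin n → X}
    (hz : ∀ k, z k ∈ S) {g : X → ℝ} {e : ℝ} (he : ∀ x ∈ S, |g x| ≤ e) :
    empiricalDeviation P z g ≤ 2 * e := by
  have hn' : (0 : ℝ) < n := by exact_mod_cast hn
  have h1 : (∑ k, g (z k)) / n ≤ e := by
    rw [div_le_iff₀ hn']
    calc ∑ k, g (z k) ≤ ∑ _k : Fin n, e :=
          Finset.sum_le_sum fun k _ => (abs_le.1 (he _ (hz k))).2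
      _ = e * n := by simp [mul_comm]
  have h2 : |∫ x, g x ∂P| ≤ e := by
    have := norm_integral_le_of_norm_le_const (μ := P) (f := g) (C := e)
      (by filter_upwards [hS] with x hx using he x hx)
    simpa using this
  unfold empiricalDeviation
  linarith [(abs_le.1 h2).1]

/-- Hoeffding's inequality: a variable with range of length `2 σ` is sub-Gaussian with variance
proxy `σ ^ 2`, so `σ / √n` is the scale of the average. -/
lemma measure_le_empiricalDeviation {X Ω : Type*} [MeasurableSpace X] [MeasurableSpace Ω] {n : ℕ}
    (hn : 1 ≤ n) {P : Measure X} [IsProbabilityMeasure P] {μ : Measure Ω} [IsProbabilityMeasure μ]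
    {Z : Fin n → Ω → X} (hlaw : ∀ i, HasLaw (Z i) P μ) (hindep : iIndepFun Z μ)
    {g : X → ℝ} (hg : Measurable g) {a σ : ℝ} (hσ : 0 < σ)
    (hb : ∀ᵐ x ∂P, g x ∈ Set.Icc a (a + 2 * σ)) {s : ℝ} (hs : 0 ≤ s) :
    μ {ω | σ * s / √n ≤ empiricalDeviation P (fun k => Z k ω) g} ≤
      ENNReal.ofReal (Real.exp (-(s ^ 2 / 2))) := by
  have hn' : (0 : ℝ) < n := by exact_mod_cast hn
  have hint : ∀ k, ∫ ω, g (Z k ω) ∂μ = ∫ x, g x ∂P := fun k => by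
    rw [← (hlaw k).map_eq, integral_map (hlaw k).aemeasurable hg.aestronglyMeasurable]
  have hind : iIndepFun (fun k ω => g (Z k ω) - ∫ x, g x ∂P) μ :=
    hindep.comp (fun _ x => g x - ∫ x, g x ∂P) fun _ => hg.sub_const _
  have hsub : ∀ k ∈ (Finset.univ : Finset (Fin n)),
      HasSubgaussianMGF (fun ω => g (Z k ω) - ∫ x, g x ∂P)
        ((‖a + 2 * σ - a‖₊ / 2) ^ 2) μ := by
    intro k _
    rw [← hint k]
    refine hasSubgaussianMGF_of_mem_Icc (hg.comp_aemeasurable (hlaw k).aemeasurable) ?_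
    rw [← (hlaw k).map_eq] at hb
    exact ae_of_ae_map (hlaw k).aemeasurable hb
  have hε : 0 ≤ √n * σ * s := by positivity
  have key := HasSubgaussianMGF.measure_sum_ge_le_of_iIndepFun hind hsub hε
  have hset : {ω | σ * s / √n ≤ empiricalDeviation P (fun k => Z k ω) g} =
      {ω | √n * σ * s ≤ ∑ k, (g (Z k ω) - ∫ x, g x ∂P)} := by
    ext ω
    simp only [Set.mem_ofPred_eq, empiricalDeviation]
    have e1 : ∑ k, (g (Z k ω) - ∫ x, g x ∂P) =
        n * ((∑ k, g (Z k ω)) / n - ∫ x, g x ∂P) := by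
      rw [Finset.sum_sub_distrib]
      simp
      field_simp
    have e2 : √n * σ * s = n * (σ * s / √n) := by
      have : (n : ℝ) = √n * √n := (Real.mul_self_sqrt hn'.le).symm
      have h0 : √(n : ℝ) ≠ 0 := by positivity
      field_simp
      rw [Real.sq_sqrt hn'.le, mul_comm]
    rw [e1, e2, mul_le_mul_iff_right₀ hn']
  rw [hset, ← ofReal_measureReal (measure_ne_top _ _)]
  refine ENNReal.ofReal_le_ofReal (key.trans (Real.exp_le_exp.2 (le_of_eq ?_)))
  have e3 : ((∑ k : Fin n, (‖a + 2 * σ - a‖₊ / 2) ^ 2 : NNReal) : ℝ) = n * σ ^ 2 := by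
    simp [abs_of_pos hσ]
  rw [e3, mul_pow, mul_pow, Real.sq_sqrt hn'.le]
  field_simp

/-- Simultaneous deviation bounds for a sequence of finite families of functions. -/
lemma exists_event_empiricalDeviation_le {X Ω : Type*} [MeasurableSpace X] [MeasurableSpace Ω]
    {n : ℕ} (hn : 1 ≤ n) {P : Measure X} [IsProbabilityMeasure P] {μ : Measure Ω}
    [IsProbabilityMeasure μ] {Z : Fin n → Ω → X} (hlaw : ∀ i, HasLaw (Z i) P μ)
    (hindep : iIndepFun Z μ) {S : Set X} (hS : ∀ᵐ x ∂P, x ∈ S)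
    {G : ℕ → Set (X → ℝ)} {A σ : ℕ → ℝ} (hfin : ∀ j, (G j).Finite) (hA : ∀ j, 0 ≤ A j)
    (hcard : ∀ j, ((G j).ncard : ℝ) * 2 ^ (j + 1) ≤ Real.exp (A j ^ 2 / 2))
    (hσ : ∀ j, 0 < σ j) (hmeas : ∀ j, ∀ g ∈ G j, Measurable g)
    (hosc : ∀ j, ∀ g ∈ G j, ∀ x ∈ S, ∀ y ∈ S, g x - g y ≤ 2 * σ j)
    {α : ℝ} (hα0 : 0 < α) (hα1 : α ≤ 1) :
    ∃ E : Set Ω, MeasurableSet E ∧ ENNReal.ofReal (1 - α) ≤ μ E ∧ ∀ ω ∈ E, (∀ k, Z k ω ∈ S) ∧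
      ∀ j, ∀ g ∈ G j, empiricalDeviation P (fun k => Z k ω) g ≤
        σ j * (A j + √(2 * Real.log (1 / α))) / √n := by
  set B := √(2 * Real.log (1 / α)) with hB
  have hB0 : 0 ≤ B := Real.sqrt_nonneg _
  have hBexp : Real.exp (-(B ^ 2 / 2)) = α := by
    have : 0 ≤ Real.log (1 / α) := Real.log_nonneg (by rw [le_div_iff₀ hα0]; linarith)
    rw [hB, Real.sq_sqrt (by linarith), mul_div_cancel_left₀ _ two_ne_zero, one_div, Real.log_inv,
      neg_neg, Real.exp_log hα0]
  obtain ⟨x₀, hx₀⟩ := hS.exists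
  let bad : (X → ℝ) → ℕ → Set Ω := fun g j =>
    {ω | σ j * (A j + B) / √n ≤ empiricalDeviation P (fun k => Z k ω) g}
  have hbad : ∀ j, ∀ g ∈ G j, μ (bad g j) ≤ ENNReal.ofReal (Real.exp (-((A j + B) ^ 2 / 2))) := by
    intro j g hg
    have hbdd : BddAbove (g '' S) := ⟨g x₀ + 2 * σ j, by
      rintro _ ⟨x, hx, rfl⟩
      linarith [hosc j g hg x hx x₀ hx₀]⟩
    refine measure_le_empiricalDeviation hn hlaw hindep (hmeas j g hg)
      (a := sSup (g '' S) - 2 * σ j) (hσ j) ?_ (add_nonneg (hA j) hB0)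
    filter_upwards [hS] with x hx
    constructor
    · rw [sub_le_iff_le_add]
      refine csSup_le ⟨_, x, hx, rfl⟩ ?_
      rintro _ ⟨y, hy, rfl⟩
      linarith [hosc j g hg y hy x hx]
    · rw [sub_add_cancel]
      exact le_csSup hbdd ⟨x, hx, rfl⟩
  have hlevel : ∀ j, μ (⋃ g ∈ G j, bad g j) ≤ ENNReal.ofReal (α / 2 / 2 ^ j) := by
    intro j
    have e1 : (⋃ g ∈ G j, bad g j) = ⋃ g ∈ (hfin j).toFinset, bad g j := by simp
    rw [e1]
    refine (measure_biUnion_finset_le _ _).trans ((Finset.sum_le_card_nsmul _ _ _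
      fun g hg => hbad j g ((hfin j).mem_toFinset.1 hg)).trans ?_)
    rw [← Set.ncard_eq_toFinset_card _ (hfin j), nsmul_eq_mul, ← ENNReal.ofReal_natCast,
      ← ENNReal.ofReal_mul (Nat.cast_nonneg _)]
    refine ENNReal.ofReal_le_ofReal ?_
    -- Since `(A + B) ^ 2 ≥ A ^ 2 + B ^ 2`, the tail factors: the part in `A j` pays for the union
    -- bound and for the weight `2 ^ (-(j + 1))`, the part in `B` is exactly `α`.
    have e2 : Real.exp (-((A j + B) ^ 2 / 2)) ≤ Real.exp (-(A j ^ 2 / 2)) * α := by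
      rw [← hBexp, ← Real.exp_add]
      apply Real.exp_le_exp.2
      nlinarith [mul_nonneg (hA j) hB0]
    have e3 := hcard j
    calc ((G j).ncard : ℝ) * Real.exp (-((A j + B) ^ 2 / 2))
        ≤ (Real.exp (A j ^ 2 / 2) / 2 ^ (j + 1)) * (Real.exp (-(A j ^ 2 / 2)) * α) := by
          gcongr
          rwa [le_div_iff₀ (by positivity)]
      _ = (Real.exp (A j ^ 2 / 2) * Real.exp (-(A j ^ 2 / 2))) * (α / 2 / 2 ^ j) := by
          field_simp; ring
      _ = α / 2 / 2 ^ j := by rw [← Real.exp_add, add_neg_cancel, Real.exp_zero, one_mul]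
  let Bad : Set Ω := (⋃ j, ⋃ g ∈ G j, bad g j) ∪ {ω | ¬ ∀ k, Z k ω ∈ S}
  have hnull : μ {ω | ¬ ∀ k, Z k ω ∈ S} = 0 := by
    rw [← ae_iff, ae_all_iff]
    intro k
    have := hS
    rw [← (hlaw k).map_eq] at this
    exact ae_of_ae_map (hlaw k).aemeasurable this
  have hBad : μ Bad ≤ ENNReal.ofReal α := by
    refine (measure_union_le _ _).trans ?_
    rw [hnull, add_zero]
    refine (measure_iUnion_le _).trans ((ENNReal.tsum_le_tsum hlevel).trans ?_)
    rw [← ENNReal.ofReal_tsum_of_nonneg (fun j => by positivity) (summable_geometric_two' α),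
      tsum_geometric_two']
  -- The `Z k` are only a.e. measurable, so `Bad` is replaced by a measurable hull of the same
  -- measure.
  refine ⟨(toMeasurable μ Bad)ᶜ, (measurableSet_toMeasurable _ _).compl, ?_, ?_⟩
  · rw [prob_compl_eq_one_sub (measurableSet_toMeasurable _ _), measure_toMeasurable,
      ENNReal.ofReal_sub _ hα0.le, ENNReal.ofReal_one]
    exact tsub_le_tsub_left hBad 1
  · intro ω hω
    have hω' : ω ∉ Bad := fun h => hω (subset_toMeasurable μ Bad h)
    simp only [Bad, Set.mem_union, not_or, Set.mem_iUnion, not_exists, Set.mem_ofPred_eq,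
      not_not] at hω'
    exact ⟨hω'.2, fun j g hg => (not_le.1 (hω'.1 j g hg)).le⟩

/-- Chaining bound for a class of functions with codes of log-size `O(a * 4 ^ j)` at
scale `4 ^ (-j)`. -/
theorem exists_event_forall_empiricalDeviation_le {X Ω ι : Type*} [MeasurableSpace X]
    [MeasurableSpace Ω] [Nonempty ι]
    {n : ℕ} (hn : 1 ≤ n) {P : Measure X} [IsProbabilityMeasure P] {μ : Measure Ω}
    [IsProbabilityMeasure μ] {Z : Fin n → Ω → X} (hlaw : ∀ i, HasLaw (Z i) P μ)
    (hindep : iIndepFun Z μ) {S : Set X} (hS : ∀ᵐ x ∂P, x ∈ S)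
    {f : ι → X → ℝ} (hf : ∀ i, Measurable (f i)) {D a : ℝ} (hD : 0 < D) (ha : 1 ≤ a)
    (hosc : ∀ i, ∀ x ∈ S, ∀ y ∈ S, f i x - f i y ≤ D)
    (hcode : ∀ j : ℕ, ∃ (T : Type) (_ : Fintype T) (c : ι → T),
      (Fintype.card T : ℝ) ≤ Real.exp (76 * a * 4 ^ j) ∧
      ∀ p q, c p = c q → ∀ x ∈ S, |f p x - f q x| ≤ D / 8 * (1 / 4) ^ j)
    {α : ℝ} (hα0 : 0 < α) (hα1 : α ≤ 1) :
    ∃ E : Set Ω, MeasurableSet E ∧ ENNReal.ofReal (1 - α) ≤ μ E ∧ ∀ ω ∈ E, (∀ k, Z k ω ∈ S) ∧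
      ∀ i, empiricalDeviation P (fun k => Z k ω) (f i) ≤
        D * (24 * √a + √(2 * Real.log (1 / α))) / √n := by
  choose T hT c hc1 hc2 using hcode
  obtain ⟨x₀, hx₀⟩ := hS.exists
  -- A representative of each word, taken in the class itself. Its value on words that do not occur
  -- is irrelevant.
  let r : ∀ j, T j → ι := fun j => Function.invFun (c j)
  have hr : ∀ j i, ∀ x ∈ S, |f i x - f (r j (c j i)) x| ≤ D / 8 * (1 / 4) ^ j := fun j i x hx =>
    hc2 j _ _ (Function.invFun_eq ⟨i, rfl⟩).symm x hx
  -- Links of the chain. Both words come from the same `i`; for arbitrary pairs of words the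
  -- difference need not be small.
  let G : ℕ → Set (X → ℝ) := fun j => match j with
    | 0 => Set.range fun i => f (r 0 (c 0 i))
    | j + 1 => Set.range fun i => f (r (j + 1) (c (j + 1) i)) - f (r j (c j i))
  have hG0 : G 0 ⊆ (fun t => f (r 0 t)) '' Set.univ := by
    rintro _ ⟨i, rfl⟩
    exact ⟨c 0 i, trivial, rfl⟩
  have hG1 : ∀ j, G (j + 1) ⊆
      (fun t : T (j + 1) × T j => f (r (j + 1) t.1) - f (r j t.2)) '' Set.univ := by
    rintro j _ ⟨i, rfl⟩
    exact ⟨(c (j + 1) i, c j i), trivial, rfl⟩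
  have hsq : ∀ j : ℕ, (16 * 2 ^ j * √a) ^ 2 / 2 = 128 * a * 4 ^ j := fun j => by
    rw [mul_pow, mul_pow, Real.sq_sqrt (by linarith), ← pow_mul, mul_comm j 2, pow_mul]
    ring
  have hpow : ∀ m : ℕ, (2 : ℝ) ^ m ≤ Real.exp m := fun m => by
    rw [← mul_one (m : ℝ), Real.exp_nat_mul]
    gcongr
    linarith [Real.add_one_le_exp (1 : ℝ)]
  obtain ⟨E, hE1, hE2, hE3⟩ := exists_event_empiricalDeviation_le hn hlaw hindep hS (G := G)
    -- The `σ j` sum to `D`, so `B` enters the final bound with coefficient `D`; the `σ j * A j` sum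
    -- to `24 * D * √a`. The factor 16 gives `A j ^ 2 / 2 = 128 a 4 ^ j`, above the log-size `95 a 4
    -- ^ j` of pairs of words at consecutive levels plus the weight.
    (A := fun j => 16 * 2 ^ j * √a) (σ := fun j => 3 / 4 * D * (1 / 4) ^ j)
    (by
      rintro (_ | j)
      · exact (Set.toFinite _).subset hG0
      · exact (Set.toFinite _).subset (hG1 j))
    (fun j => by positivity)
    (by
      intro j
      rw [hsq]
      rcases j with _ | j
      · have e1 : ((G 0).ncard : ℝ) ≤ Fintype.card (T 0) := by
          refine Nat.cast_le.2 ((Set.ncard_le_ncard hG0 (Set.toFinite _)).trans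
            ((Set.ncard_image_le (Set.toFinite _)).trans ?_))
          rw [Set.ncard_univ, Nat.card_eq_fintype_card]
        calc ((G 0).ncard : ℝ) * 2 ^ (0 + 1) ≤ Real.exp (76 * a * 4 ^ 0) * Real.exp ((1 : ℕ)) := by
              gcongr
              exacts [e1.trans (hc1 0), hpow 1]
          _ ≤ Real.exp (128 * a * 4 ^ 0) := by
              rw [← Real.exp_add]
              apply Real.exp_le_exp.2
              push_cast
              linarith
      · have e1 : ((G (j + 1)).ncard : ℝ) ≤ Fintype.card (T (j + 1)) * Fintype.card (T j) := by
          rw [← Nat.cast_mul, ← Fintype.card_prod]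
          refine Nat.cast_le.2 ((Set.ncard_le_ncard (hG1 j) (Set.toFinite _)).trans
            ((Set.ncard_image_le (Set.toFinite _)).trans ?_))
          rw [Set.ncard_univ, Nat.card_eq_fintype_card]
        calc ((G (j + 1)).ncard : ℝ) * 2 ^ (j + 1 + 1)
            ≤ (Real.exp (76 * a * 4 ^ (j + 1)) * Real.exp (76 * a * 4 ^ j)) *
              Real.exp ((j + 1 + 1 : ℕ)) := by
              gcongr
              · exact e1.trans (by gcongr <;> exact hc1 _)
              · exact hpow _
          _ ≤ Real.exp (128 * a * 4 ^ (j + 1)) := by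
              rw [← Real.exp_add, ← Real.exp_add]
              apply Real.exp_le_exp.2
              have h1 : (j : ℝ) + 1 ≤ 4 ^ j := by
                exact_mod_cast Nat.succ_le_of_lt (Nat.lt_pow_self (n := j) (a := 4) (by norm_num))
              have h2 : (4 : ℝ) ^ j ≤ a * 4 ^ j := le_mul_of_one_le_left (by positivity) ha
              push_cast
              rw [pow_succ]
              linarith [(Nat.cast_nonneg j : (0 : ℝ) ≤ j)])
    (fun j => by positivity)
    (by
      rintro (_ | j) _ ⟨i, rfl⟩
      · exact hf _
      · exact (hf _).sub (hf _))
    (by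
      rintro (_ | j) _ ⟨i, rfl⟩ x hx y hy
      · simp only [pow_zero]
        linarith [hosc (r 0 (c 0 i)) x hx y hy]
      -- A link is at most `(D / 8) (1 + 1 / 4) 4 ^ (-j)` in absolute value, so it oscillates by at
      -- most `(5 / 16) D 4 ^ (-j)`, below `2 σ (j + 1) = (3 / 8) D 4 ^ (-j)`.
      · simp only [Pi.sub_apply]
        have e1 := abs_le.1 (hr j i x hx)
        have e2 := abs_le.1 (hr j i y hy)
        have e3 := abs_le.1 (hr (j + 1) i x hx)
        have e4 := abs_le.1 (hr (j + 1) i y hy)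
        have e5 : 0 < D * (1 / 4) ^ j := by positivity
        rw [pow_succ] at *
        linarith [e1.1, e1.2, e2.1, e2.2, e3.1, e3.2, e4.1, e4.2])
    hα0 hα1
  refine ⟨E, hE1, hE2, fun ω hω => ⟨(hE3 ω hω).1, fun i => ?_⟩⟩
  obtain ⟨hZ, hdev⟩ := hE3 ω hω
  set B := √(2 * Real.log (1 / α)) with hB
  have hB0 : 0 ≤ B := Real.sqrt_nonneg _
  have hint : ∀ i, Integrable (f i) P := fun i => by
    refine integrable_of_abs_le_on hS (hf i) (e := |f i x₀| + D) fun x hx => ?_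
    have h1 := hosc i x hx x₀ hx₀
    have h2 := hosc i x₀ hx₀ x hx
    rw [abs_le]
    constructor <;> linarith [neg_abs_le (f i x₀), le_abs_self (f i x₀)]
  have hn' : (0 : ℝ) < √n := Real.sqrt_pos.2 (by exact_mod_cast hn)
  have hchain : ∀ J : ℕ, empiricalDeviation P (fun k => Z k ω) (f (r J (c J i))) ≤
      D * (12 * √a * (2 - (1 / 2) ^ J) + B * (1 - (1 / 4) ^ (J + 1))) / √n := by
    intro J
    induction J with
    | zero =>
      refine (hdev 0 _ ⟨i, rfl⟩).trans (le_of_eq ?_)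
      ring
    | succ J ih =>
      have h := hdev (J + 1) _ ⟨i, rfl⟩
      rw [empiricalDeviation_sub _ (hint _) (hint _)] at h
      refine (sub_le_iff_le_add.1 h).trans ((add_le_add_right ih _).trans (le_of_eq ?_))
      have e1 : (1 / 4 : ℝ) ^ (J + 1) * 2 ^ (J + 1) = (1 / 2) ^ (J + 1) := by
        rw [← mul_pow]; norm_num
      have e2 : (3 / 4 * D * (1 / 4) ^ (J + 1) * (16 * 2 ^ (J + 1) * √a + B)) =
          12 * D * √a * ((1 / 4) ^ (J + 1) * 2 ^ (J + 1)) + 3 / 4 * D * B * (1 / 4) ^ (J + 1) := by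
        ring
      rw [e2, e1, ← add_div]
      congr 1
      ring
  -- The unresolved remainder is controlled in sup norm on `S`, without probability, and vanishes as
  -- `J` grows.
  have hlim : ∀ J : ℕ, empiricalDeviation P (fun k => Z k ω) (f i) ≤
      D * (24 * √a + B) / √n + D / 4 * (1 / 4) ^ J := by
    intro J
    have h1 := empiricalDeviation_le_two_mul hn hS hZ (g := f i - f (r J (c J i))) (hr J i)
    rw [empiricalDeviation_sub _ (hint _) (hint _)] at h1
    have h2 : D * (12 * √a * (2 - (1 / 2) ^ J) + B * (1 - (1 / 4) ^ (J + 1))) / √n ≤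
        D * (24 * √a + B) / √n := by
      refine div_le_div_of_nonneg_right (mul_le_mul_of_nonneg_left ?_ hD.le) hn'.le
      have h3 : 0 ≤ 12 * √a * (1 / 2) ^ J := by positivity
      have h4 : 0 ≤ B * (1 / 4) ^ (J + 1) := by positivity
      linarith
    linarith [hchain J]
  refine ge_of_tendsto' (x := Filter.atTop) ?_ hlim
  have := (tendsto_pow_atTop_nhds_zero_of_lt_one (r := (1 / 4 : ℝ)) (by norm_num)
    (by norm_num)).const_mul (D / 4)
  simpa using this.const_add (D * (24 * √a + B) / √n)

/-! ### Quantile coupling and duality on the line -/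

/-- The quantile function of a distribution function `F`, with values in `[a, b]`. -/
noncomputable def quantileOn (a b : ℝ) (F : ℝ → ℝ) (u : ℝ) : ℝ :=
  sInf (insert b {t | t ∈ Set.Icc a b ∧ u ≤ F t})

section Quantile

variable {a b : ℝ}

lemma bddBelow_quantileOn (hab : a ≤ b) (F : ℝ → ℝ) (u : ℝ) :
    BddBelow (insert b {t | t ∈ Set.Icc a b ∧ u ≤ F t}) := by
  refine ⟨a, ?_⟩
  rintro t (rfl | ht)
  exacts [hab, ht.1.1]

lemma monotone_quantileOn (hab : a ≤ b) (F : ℝ → ℝ) : Monotone (quantileOn a b F) := by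
  intro u v huv
  refine csInf_le_csInf (bddBelow_quantileOn hab F u) (Set.insert_nonempty _ _) ?_
  exact Set.insert_subset_insert fun t ht => ⟨ht.1, huv.trans ht.2⟩

lemma quantileOn_mem_Icc (hab : a ≤ b) (F : ℝ → ℝ) (u : ℝ) :
    quantileOn a b F u ∈ Set.Icc a b := by
  constructor
  · refine le_csInf (Set.insert_nonempty _ _) ?_
    rintro t (rfl | ht)
    exacts [hab, ht.1.1]
  · exact csInf_le (bddBelow_quantileOn hab F u) (Set.mem_insert _ _)

lemma cdf_eq_zero_of_lt {μ : Measure ℝ} [IsProbabilityMeasure μ]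
    (hμ : ∀ᵐ x ∂μ, x ∈ Set.Icc a b) {t : ℝ} (ht : t < a) : cdf μ t = 0 := by
  rw [cdf_eq_real, measureReal_def]
  have : μ (Set.Iic t) = 0 := by
    rw [measure_eq_zero_iff_ae_notMem]
    filter_upwards [hμ] with x hx
    exact fun h => absurd (hx.1.trans h) (not_le.2 ht)
  simp [this]

lemma cdf_eq_one_of_le {μ : Measure ℝ} [IsProbabilityMeasure μ]
    (hμ : ∀ᵐ x ∂μ, x ∈ Set.Icc a b) {t : ℝ} (ht : b ≤ t) : cdf μ t = 1 := by
  rw [cdf_eq_real, measureReal_def]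
  have : μ (Set.Iic t) = 1 := by
    rw [← mem_ae_iff_prob_eq_one measurableSet_Iic]
    filter_upwards [hμ] with x hx using hx.2.trans ht
  simp [this]

/-- Right continuity of the distribution function makes the infimum attained. The inserted point `b`
does no harm, as the distribution function is 1 there, and `u > 0` excludes `t < a`. -/
lemma quantileOn_cdf_le_iff (hab : a ≤ b) {μ : Measure ℝ} [IsProbabilityMeasure μ]
    (hμ : ∀ᵐ x ∂μ, x ∈ Set.Icc a b) {u : ℝ} (hu : u ∈ Set.Ioc (0 : ℝ) 1) (t : ℝ) :
    quantileOn a b (cdf μ) u ≤ t ↔ u ≤ cdf μ t := by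
  constructor
  · intro h
    by_contra! hlt
    have hc : ∀ᶠ x in nhdsWithin t (Set.Ici t), cdf μ x < u :=
      ((cdf μ).right_continuous t).eventually (gt_mem_nhds hlt)
    obtain ⟨s, hs, hsub⟩ := mem_nhdsGE_iff_exists_Ico_subset.1 hc
    have hle : s ≤ quantileOn a b (cdf μ) u := by
      refine le_csInf (Set.insert_nonempty _ _) fun x hx => ?_
      have hux : u ≤ cdf μ x := by
        rcases hx with rfl | hx
        · rw [cdf_eq_one_of_le hμ le_rfl]; exact hu.2
        · exact hx.2
      by_contra! hxs
      rcases le_or_gt t x with htx | htx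
      · exact absurd (hsub ⟨htx, hxs⟩) (not_lt.2 hux)
      · exact absurd (hux.trans (monotone_cdf μ htx.le)) (not_le.2 hlt)
    exact absurd (hle.trans h) (not_le.2 hs)
  · intro h
    rcases lt_or_ge t a with hta | hta
    · rw [cdf_eq_zero_of_lt hμ hta] at h
      exact absurd hu.1 (not_lt.2 h)
    rcases le_or_gt t b with htb | htb
    · exact csInf_le (bddBelow_quantileOn hab _ u) (Set.mem_insert_of_mem _ ⟨⟨hta, htb⟩, h⟩)
    · exact (quantileOn_mem_Icc hab _ u).2.trans htb.le

lemma map_quantileOn_cdf (hab : a ≤ b) {μ : Measure ℝ} [IsProbabilityMeasure μ]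
    (hμ : ∀ᵐ x ∂μ, x ∈ Set.Icc a b) :
    (volume.restrict (Set.Ioc (0 : ℝ) 1)).map (quantileOn a b (cdf μ)) = μ := by
  have hm := (monotone_quantileOn hab (cdf μ)).measurable
  have hfin : IsFiniteMeasure ((volume.restrict (Set.Ioc (0 : ℝ) 1)).map
    (quantileOn a b (cdf μ))) := inferInstance
  refine Measure.ext_of_Iic _ _ fun t => ?_
  rw [Measure.map_apply hm measurableSet_Iic, Measure.restrict_apply (hm measurableSet_Iic),
    ← ofReal_cdf]
  have : quantileOn a b (cdf μ) ⁻¹' Set.Iic t ∩ Set.Ioc 0 1 = Set.Ioc 0 (cdf μ t) := by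
    ext u
    simp only [Set.mem_inter_iff, Set.mem_preimage, Set.mem_Iic]
    constructor
    · rintro ⟨h, hu⟩
      exact ⟨hu.1, (quantileOn_cdf_le_iff hab hμ hu t).1 h⟩
    · rintro ⟨h0, h⟩
      have hu : u ∈ Set.Ioc (0 : ℝ) 1 := ⟨h0, h.trans (cdf_le_one μ t)⟩
      exact ⟨(quantileOn_cdf_le_iff hab hμ hu t).2 h, hu⟩
  rw [this, Real.volume_Ioc, sub_zero]

/-- Both sides are the area between the two graphs, sliced in the two directions (Tonelli); the
Galois property `quantileOn_cdf_le_iff` identifies the slices. -/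
lemma lintegral_abs_quantileOn_sub (hab : a ≤ b) {μ ν : Measure ℝ} [IsProbabilityMeasure μ]
    [IsProbabilityMeasure ν] (hμ : ∀ᵐ x ∂μ, x ∈ Set.Icc a b) (hν : ∀ᵐ x ∂ν, x ∈ Set.Icc a b) :
    ∫⁻ u in Set.Ioc (0 : ℝ) 1,
      ENNReal.ofReal |quantileOn a b (cdf μ) u - quantileOn a b (cdf ν) u| =
    ∫⁻ t, ENNReal.ofReal |cdf μ t - cdf ν t| := by
  set p := quantileOn a b (cdf μ) with hp
  set q := quantileOn a b (cdf ν) with hq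
  have hpm : Measurable p := (monotone_quantileOn hab (cdf μ)).measurable
  have hqm : Measurable q := (monotone_quantileOn hab (cdf ν)).measurable
  let A : Set (ℝ × ℝ) := {z | min (p z.1) (q z.1) ≤ z.2 ∧ z.2 < max (p z.1) (q z.1)}
  have hA : MeasurableSet A := by
    have h1 : Measurable fun z : ℝ × ℝ => p z.1 := hpm.comp measurable_fst
    have h2 : Measurable fun z : ℝ × ℝ => q z.1 := hqm.comp measurable_fst
    exact (measurableSet_le (h1.min h2) measurable_snd).inter
      (measurableSet_lt measurable_snd (h1.max h2))
  have e1 := Measure.prod_apply (μ := volume.restrict (Set.Ioc (0 : ℝ) 1))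
    (ν := (volume : Measure ℝ)) hA
  have e2 := Measure.prod_apply_symm (μ := volume.restrict (Set.Ioc (0 : ℝ) 1))
    (ν := (volume : Measure ℝ)) hA
  rw [e1] at e2
  have h1 : ∀ u, volume (Prod.mk u ⁻¹' A) = ENNReal.ofReal |p u - q u| := by
    intro u
    have : Prod.mk u ⁻¹' A = Set.Ico (min (p u) (q u)) (max (p u) (q u)) := rfl
    rw [this, Real.volume_Ico, max_sub_min_eq_abs, abs_sub_comm]
  have h2 : ∀ t, (volume.restrict (Set.Ioc (0 : ℝ) 1)) ((fun u => (u, t)) ⁻¹' A) =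
      ENNReal.ofReal |cdf μ t - cdf ν t| := by
    intro t
    rw [Measure.restrict_apply (measurable_prodMk_right hA)]
    have : (fun u => (u, t)) ⁻¹' A ∩ Set.Ioc 0 1 =
        Set.Ioc (min (cdf μ t) (cdf ν t)) (max (cdf μ t) (cdf ν t)) := by
      ext u
      simp only [A, Set.mem_inter_iff, Set.mem_preimage, Set.mem_ofPred_eq]
      constructor
      · rintro ⟨⟨hl, hr⟩, hu⟩
        rw [min_le_iff, hp, hq, quantileOn_cdf_le_iff hab hμ hu,
          quantileOn_cdf_le_iff hab hν hu] at hl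
        rw [lt_max_iff, ← not_le, ← not_le, hp, hq, quantileOn_cdf_le_iff hab hμ hu,
          quantileOn_cdf_le_iff hab hν hu, not_le, not_le] at hr
        exact ⟨min_lt_iff.2 hr, le_max_iff.2 hl⟩
      · rintro ⟨hl, hr⟩
        have hu : u ∈ Set.Ioc (0 : ℝ) 1 :=
          ⟨(le_min (cdf_nonneg μ t) (cdf_nonneg ν t)).trans_lt hl,
            hr.trans (max_le (cdf_le_one μ t) (cdf_le_one ν t))⟩
        rw [min_le_iff, lt_max_iff, ← not_le, ← not_le, hp, hq, quantileOn_cdf_le_iff hab hμ hu,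
          quantileOn_cdf_le_iff hab hν hu, not_le, not_le]
        exact ⟨⟨le_max_iff.1 hr, min_lt_iff.1 hl⟩, hu⟩
    rw [this, Real.volume_Ioc, max_sub_min_eq_abs, abs_sub_comm]
  simp only [h1, h2] at e2
  exact e2

/-- Fubini, after writing `cdf μ t` as the integral of the indicator of `x ≤ t`. -/
lemma integral_mul_cdf {μ : Measure ℝ} [IsProbabilityMeasure μ]
    (hμ : ∀ᵐ x ∂μ, x ∈ Set.Icc a b) {s : ℝ → ℝ} (hs : Measurable s) (hs1 : ∀ t, |s t| ≤ 1) :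
    ∫ t in Set.Icc a b, s t * cdf μ t = ∫ x, (∫ t in x..b, s t) ∂μ := by
  have hind : Measurable fun z : ℝ × ℝ => Set.indicator {z : ℝ × ℝ | z.2 ≤ z.1}
      (fun z => s z.1) z :=
    (hs.comp measurable_fst).indicator (measurableSet_le measurable_snd measurable_fst)
  have hint : Integrable (Function.uncurry fun t x : ℝ =>
      Set.indicator {z : ℝ × ℝ | z.2 ≤ z.1} (fun z => s z.1) (t, x))
      ((volume.restrict (Set.Icc a b)).prod μ) := by
    refine Integrable.of_bound hind.aestronglyMeasurable 1 (Filter.Eventually.of_forall ?_)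
    intro z
    simp only [Function.uncurry, Set.indicator_apply]
    split_ifs
    exacts [hs1 z.1, by simp]
  have hswap := integral_integral_swap hint
  have hl : ∀ t, ∫ x, Set.indicator {z : ℝ × ℝ | z.2 ≤ z.1} (fun z => s z.1) (t, x) ∂μ =
      s t * cdf μ t := by
    intro t
    have : (fun x => Set.indicator {z : ℝ × ℝ | z.2 ≤ z.1} (fun z => s z.1) (t, x)) =
        Set.indicator (Set.Iic t) (fun _ => s t) := by
      ext x; simp [Set.indicator_apply]
    rw [this, integral_indicator_const _ measurableSet_Iic, cdf_eq_real, smul_eq_mul, mul_comm]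
  simp only [hl] at hswap
  rw [hswap]
  refine integral_congr_ae ?_
  filter_upwards [hμ] with x hx
  have : (fun t => Set.indicator {z : ℝ × ℝ | z.2 ≤ z.1} (fun z => s z.1) (t, x)) =
      Set.indicator (Set.Ici x) s := by
    ext t; simp [Set.indicator_apply]
  rw [this, setIntegral_indicator measurableSet_Ici, intervalIntegral.integral_of_le hx.2,
    ← integral_Icc_eq_integral_Ioc]
  congr 2
  ext t
  simp only [Set.mem_inter_iff, Set.mem_Icc, Set.mem_Ici]
  exact ⟨fun h => ⟨h.2, h.1.2⟩, fun h => ⟨⟨hx.1.trans h.1, h.2⟩, h.1⟩⟩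

lemma lipschitzWith_intervalIntegral {s : ℝ → ℝ} (hs : Measurable s) (hs1 : ∀ t, |s t| ≤ 1)
    (b : ℝ) : LipschitzWith 1 fun x => ∫ t in x..b, s t := by
  have hint : ∀ x y, IntervalIntegrable s volume x y := fun x y => by
    refine (intervalIntegrable_const (c := (1 : ℝ))).mono_fun hs.aestronglyMeasurable ?_
    exact Filter.Eventually.of_forall fun t => by simpa using hs1 t
  refine LipschitzWith.of_dist_le_mul fun x y => ?_
  rw [Real.dist_eq, intervalIntegral.integral_interval_sub_interval_comm (hint _ _) (hint _ _)
    (hint _ _), intervalIntegral.integral_same, sub_zero, NNReal.coe_one, one_mul, Real.dist_eq,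
    abs_sub_comm x y]
  simpa using intervalIntegral.norm_integral_le_of_norm_le_const (f := s) (C := 1) (a := x) (b := y)
    fun t _ => hs1 t

/-- One-dimensional duality: `∫ |F - G|` is attained by a `1`-Lipschitz test function. -/
lemma exists_lipschitz_lintegral_abs_cdf_sub {μ ν : Measure ℝ}
    [IsProbabilityMeasure μ] [IsProbabilityMeasure ν] (hμ : ∀ᵐ x ∂μ, x ∈ Set.Icc a b)
    (hν : ∀ᵐ x ∂ν, x ∈ Set.Icc a b) :
    ∃ h : ℝ → ℝ, LipschitzWith 1 h ∧
      ∫⁻ t, ENNReal.ofReal |cdf μ t - cdf ν t| = ENNReal.ofReal (∫ x, h x ∂μ - ∫ x, h x ∂ν) := by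
  have hF : Measurable (cdf μ) := (monotone_cdf μ).measurable
  have hG : Measurable (cdf ν) := (monotone_cdf ν).measurable
  -- The sign of `F - G`. The test function is its integral from `x` to `b`, which is 1-Lipschitz
  -- because `|s| ≤ 1`.
  let s : ℝ → ℝ := fun t => if cdf ν t ≤ cdf μ t then 1 else -1
  have hs : Measurable s :=
    Measurable.ite (measurableSet_le hG hF) measurable_const measurable_const
  have hs1 : ∀ t, |s t| ≤ 1 := fun t => by
    simp only [s]; split_ifs <;> simp
  refine ⟨_, lipschitzWith_intervalIntegral hs hs1 b, ?_⟩
  have hint : ∀ (ρ : Measure ℝ) [IsProbabilityMeasure ρ],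
      Integrable (fun t => s t * cdf ρ t) (volume.restrict (Set.Icc a b)) := fun ρ _ => by
    refine Integrable.of_bound (hs.mul (monotone_cdf ρ).measurable).aestronglyMeasurable 1
      (Filter.Eventually.of_forall fun t => ?_)
    rw [Real.norm_eq_abs, abs_mul, abs_of_nonneg (cdf_nonneg ρ t)]
    exact mul_le_one₀ (hs1 t) (cdf_nonneg ρ t) (cdf_le_one ρ t)
  rw [← integral_mul_cdf hμ hs hs1, ← integral_mul_cdf hν hs hs1,
    ← integral_sub (hint μ) (hint ν)]
  have habs : ∀ t, s t * cdf μ t - s t * cdf ν t = |cdf μ t - cdf ν t| := fun t => by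
    simp only [s]
    split_ifs with h
    · rw [abs_of_nonneg (by linarith)]; ring
    · rw [abs_of_neg (by linarith)]; ring
  simp only [habs]
  have hi := (hint μ).sub (hint ν)
  rw [ofReal_integral_eq_lintegral_ofReal (by
      refine hi.congr (Filter.Eventually.of_forall fun t => ?_)
      exact habs t)
    (Filter.Eventually.of_forall fun t => abs_nonneg _),
    ← lintegral_indicator measurableSet_Icc]
  refine lintegral_congr fun t => ?_
  by_cases ht : t ∈ Set.Icc a b
  · rw [Set.indicator_of_mem ht]
  · rw [Set.indicator_of_notMem ht]
    rw [Set.mem_Icc, not_and_or, not_le, not_le] at ht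
    rcases ht with h | h
    · rw [cdf_eq_zero_of_lt hμ h, cdf_eq_zero_of_lt hν h]; simp
    · rw [cdf_eq_one_of_le hμ h.le, cdf_eq_one_of_le hν h.le]; simp

/-- On an interval of length `b - a`, the `r`-th power of the Wasserstein distance of order `r` is
at most `(b - a) ^ (r - 1)` times the dual (Kantorovich) distance. -/
theorem wasserstein_rpow_le (hab : a ≤ b) {r K : ℝ} (hr : 1 ≤ r) {μ ν : Measure ℝ}
    [IsProbabilityMeasure μ] [IsProbabilityMeasure ν] (hμ : ∀ᵐ x ∂μ, x ∈ Set.Icc a b)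
    (hν : ∀ᵐ x ∂ν, x ∈ Set.Icc a b)
    (hK : ∀ h : ℝ → ℝ, LipschitzWith 1 h → ∫ x, h x ∂μ - ∫ x, h x ∂ν ≤ K) :
    wasserstein r μ ν ^ r ≤ ENNReal.ofReal ((b - a) ^ (r - 1) * K) := by
  set p := quantileOn a b (cdf μ) with hp
  set q := quantileOn a b (cdf ν) with hq
  have hpm : Measurable p := (monotone_quantileOn hab (cdf μ)).measurable
  have hqm : Measurable q := (monotone_quantileOn hab (cdf ν)).measurable
  have hr0 : 0 < r := by linarith
  -- Both quantile functions are driven by the same uniform variable. Only an upper bound is needed,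
  -- so optimality of this coupling plays no role.
  let π := (volume.restrict (Set.Ioc (0 : ℝ) 1)).map fun u => (p u, q u)
  have hπ : π ∈ couplings μ ν := by
    constructor
    · rw [Measure.map_map measurable_fst (hpm.prodMk hqm)]
      exact map_quantileOn_cdf hab hμ
    · rw [Measure.map_map measurable_snd (hpm.prodMk hqm)]
      exact map_quantileOn_cdf hab hν
  have h1 : wasserstein r μ ν ^ r ≤ ∫⁻ z, ENNReal.ofReal (|z.1 - z.2| ^ r) ∂π := by
    calc wasserstein r μ ν ^ r
        ≤ ((∫⁻ z, ENNReal.ofReal (|z.1 - z.2| ^ r) ∂π) ^ (1 / r)) ^ r :=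
          ENNReal.rpow_le_rpow (iInf₂_le π hπ) hr0.le
      _ = _ := by rw [← ENNReal.rpow_mul, one_div_mul_cancel hr0.ne', ENNReal.rpow_one]
  refine h1.trans ?_
  have hcost : Measurable fun z : ℝ × ℝ => ENNReal.ofReal (|z.1 - z.2| ^ r) := by fun_prop
  rw [lintegral_map hcost (hpm.prodMk hqm)]
  obtain ⟨h, hh, he⟩ := exists_lipschitz_lintegral_abs_cdf_sub hμ hν
  calc ∫⁻ u in Set.Ioc (0 : ℝ) 1, ENNReal.ofReal (|p u - q u| ^ r)
      ≤ ∫⁻ u in Set.Ioc (0 : ℝ) 1,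
          ENNReal.ofReal ((b - a) ^ (r - 1)) * ENNReal.ofReal |p u - q u| := by
        refine lintegral_mono fun u => ?_
        rw [← ENNReal.ofReal_mul (Real.rpow_nonneg (sub_nonneg.2 hab) _)]
        refine ENNReal.ofReal_le_ofReal ?_
        have e : |p u - q u| ^ r = |p u - q u| ^ (r - 1) * |p u - q u| := by
          rw [← Real.rpow_add_one' (abs_nonneg _) (by linarith)]
          congr 1
          ring
        rw [e]
        refine mul_le_mul_of_nonneg_right (Real.rpow_le_rpow (abs_nonneg _) ?_ (by linarith))
          (abs_nonneg _)
        have e1 := quantileOn_mem_Icc hab (cdf μ) u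
        have e2 := quantileOn_mem_Icc hab (cdf ν) u
        rw [abs_le]
        constructor <;> linarith [e1.1, e1.2, e2.1, e2.2]
    _ = ENNReal.ofReal ((b - a) ^ (r - 1)) * ENNReal.ofReal (∫ x, h x ∂μ - ∫ x, h x ∂ν) := by
        rw [lintegral_const_mul' _ _ ENNReal.ofReal_ne_top,
          lintegral_abs_quantileOn_sub hab hμ hν, he]
    _ ≤ ENNReal.ofReal ((b - a) ^ (r - 1) * K) := by
        rw [← ENNReal.ofReal_mul (Real.rpow_nonneg (sub_nonneg.2 hab) _)]
        exact ENNReal.ofReal_le_ofReal (mul_le_mul_of_nonneg_left (hK h hh)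
          (Real.rpow_nonneg (sub_nonneg.2 hab) _))

end Quantile

/-! ### The dual norm and the dual diameter -/

lemma Seminorm.exists_norm_le_mul {E F : Type*} [AddCommGroup E] [Module ℝ E]
    [FiniteDimensional ℝ E] [NormedAddCommGroup F] [NormedSpace ℝ F] (N : Seminorm ℝ E)
    (hN : ∀ x, N x = 0 → x = 0) (φ : E →ₗ[ℝ] F) : ∃ C, 0 ≤ C ∧ ∀ x, ‖φ x‖ ≤ C * N x := by
  let : Norm E := ⟨N⟩
  let : NormedAddCommGroup E := NormedAddCommGroup.ofCore (N.normedSpaceCore hN)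
  let : NormedSpace ℝ E := NormedSpace.ofCore (N.normedSpaceCore hN)
  exact ⟨‖LinearMap.toContinuousLinearMap φ‖, norm_nonneg _,
    (LinearMap.toContinuousLinearMap φ).le_opNorm⟩

section DualNorm

variable {m : ℕ} {N : Seminorm ℝ (Fin m → ℝ)}

/-- Supplies the upper bounds that keep the suprema in `dualNorm` and `dualDiam` from taking the
default value 0 of an unbounded `sSup`. -/
lemma exists_dotProduct_le_mul_norm (hN : ∀ x, N x = 0 → x = 0) :
    ∃ C, 0 ≤ C ∧ ∀ x y : Fin m → ℝ, N x = 1 → x ⬝ᵥ y ≤ C * ‖y‖ := by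
  obtain ⟨C, hC, h⟩ := N.exists_norm_le_mul hN (LinearMap.id : (Fin m → ℝ) →ₗ[ℝ] (Fin m → ℝ))
  refine ⟨m * C, by positivity, fun x y hx => ?_⟩
  have hxC : ‖x‖ ≤ C := by simpa [hx] using h x
  calc x ⬝ᵥ y ≤ ∑ _i : Fin m, C * ‖y‖ := by
        refine Finset.sum_le_sum fun i _ => (le_abs_self _).trans ?_
        rw [abs_mul]
        exact mul_le_mul ((norm_le_pi_norm x i).trans hxC) (norm_le_pi_norm y i) (abs_nonneg _) hC
    _ = m * C * ‖y‖ := by simp [mul_assoc]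

lemma dotProduct_le_dualNorm (hN : ∀ x, N x = 0 → x = 0) {x : Fin m → ℝ} (hx : N x = 1)
    (y : Fin m → ℝ) : x ⬝ᵥ y ≤ dualNorm N y := by
  obtain ⟨C, -, h⟩ := exists_dotProduct_le_mul_norm hN
  refine le_csSup ⟨C * ‖y‖, ?_⟩ ⟨x, hx, rfl⟩
  rintro _ ⟨z, hz, rfl⟩
  exact h z y hz

lemma dualNorm_le_dualDiam (hN : ∀ x, N x = 0 → x = 0) {S : Set (Fin m → ℝ)}
    (hS : Bornology.IsBounded S) {x y : Fin m → ℝ} (hx : x ∈ S) (hy : y ∈ S) :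
    dualNorm N (x - y) ≤ dualDiam N S := by
  obtain ⟨C, hC, h⟩ := exists_dotProduct_le_mul_norm hN
  refine le_csSup ⟨C * Metric.diam S, ?_⟩ ⟨x, hx, y, hy, rfl⟩
  rintro _ ⟨u, hu, v, hv, rfl⟩
  refine Real.sSup_le ?_ (mul_nonneg hC Metric.diam_nonneg)
  rintro _ ⟨z, hz, rfl⟩
  refine (h z _ hz).trans (mul_le_mul_of_nonneg_left ?_ hC)
  rw [← dist_eq_norm]
  exact Metric.dist_le_diam_of_mem hS hu hv

lemma dualDiam_nonneg (hN : ∀ x, N x = 0 → x = 0) {S : Set (Fin m → ℝ)}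
    (hS : Bornology.IsBounded S) (hne : S.Nonempty) : 0 ≤ dualDiam N S := by
  obtain ⟨x, hx⟩ := hne
  refine le_trans (Real.sSup_nonneg ?_) (dualNorm_le_dualDiam hN hS hx hx)
  rintro _ ⟨z, -, rfl⟩
  simp

/-- Normalising `γ` reduces to the unit sphere, and swapping `x` and `y` gives the other sign.
General `γ` is allowed because the bound is also applied to differences of directions. -/
lemma abs_dotProduct_sub_le (hN : ∀ x, N x = 0 → x = 0) {S : Set (Fin m → ℝ)}
    (hS : Bornology.IsBounded S) (γ : Fin m → ℝ) {x y : Fin m → ℝ} (hx : x ∈ S) (hy : y ∈ S) :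
    |(x - y) ⬝ᵥ γ| ≤ N γ * dualDiam N S := by
  have key : ∀ x ∈ S, ∀ y ∈ S, (x - y) ⬝ᵥ γ ≤ N γ * dualDiam N S := by
    intro x hx y hy
    rcases eq_or_ne (N γ) 0 with h0 | h0
    · rw [hN γ h0]; simp
    · have hpos : 0 < N γ := lt_of_le_of_ne (apply_nonneg N γ) h0.symm
      have hu : N ((N γ)⁻¹ • γ) = 1 := by
        rw [map_smul_eq_mul, Real.norm_of_nonneg (inv_nonneg.2 hpos.le), inv_mul_cancel₀ h0]
      have h := (dotProduct_le_dualNorm hN hu (x - y)).trans (dualNorm_le_dualDiam hN hS hx hy)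
      rwa [smul_dotProduct, smul_eq_mul, inv_mul_le_iff₀ hpos, dotProduct_comm] at h
  rw [abs_le]
  refine ⟨?_, key x hx y hy⟩
  have := key y hy x hx
  rw [← neg_sub x y, neg_dotProduct] at this
  linarith

end DualNorm

/-! ### From the empirical process to the max-sliced distance -/

lemma isProbabilityMeasure_empirical {m n : ℕ} (hn : 1 ≤ n) (z : Fin n → Fin m → ℝ) :
    IsProbabilityMeasure (empirical z) := by
  constructor
  have hn0 : (n : ℝ≥0∞) ≠ 0 := by exact_mod_cast (by omega : n ≠ 0)
  simp [empirical, ENNReal.inv_mul_cancel hn0 (ENNReal.natCast_ne_top n)]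

lemma integral_empirical {m n : ℕ} (z : Fin n → Fin m → ℝ) (g : (Fin m → ℝ) → ℝ) :
    ∫ x, g x ∂(empirical z) = (∑ k, g (z k)) / n := by
  rw [empirical, integral_smul_measure,
    integral_finsetSum_measure fun k _ => integrable_dirac (by simp)]
  simp [div_eq_inv_mul]

/-- The max-sliced Wasserstein distance from the empirical distribution is controlled by the
empirical process indexed by ridge functions. -/
lemma maxSlicedWasserstein_empirical_rpow_le {m n : ℕ} (hn : 1 ≤ n) {N : Seminorm ℝ (Fin m → ℝ)}
    {r : ℝ} (hr : 1 ≤ r) {P : Measure (Fin m → ℝ)} [IsProbabilityMeasure P]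
    (hP : IsCompact P.support) {z : Fin n → Fin m → ℝ} (hz : ∀ k, z k ∈ P.support) {D K : ℝ}
    (hD : 0 ≤ D) (hosc : ∀ γ, N γ = 1 → ∀ x ∈ P.support, ∀ y ∈ P.support, (x - y) ⬝ᵥ γ ≤ D)
    (hK : ∀ γ, N γ = 1 → ∀ h : ℝ → ℝ, LipschitzWith 1 h →
      empiricalDeviation P z (fun x => h (x ⬝ᵥ γ)) ≤ K) :
    maxSlicedWasserstein N r (empirical z) P ^ r ≤ ENNReal.ofReal (D ^ (r - 1) * K) := by
  have hr0 : 0 < r := by linarith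
  have := isProbabilityMeasure_empirical hn z
  rw [← ENNReal.le_rpow_inv_iff hr0]
  refine iSup₂_le fun γ hγ => ?_
  rw [ENNReal.le_rpow_inv_iff hr0]
  have hγc : Continuous fun x : Fin m → ℝ => x ⬝ᵥ γ := by unfold dotProduct; fun_prop
  have hγm := hγc.measurable
  have : IsProbabilityMeasure (proj γ (empirical z)) :=
    Measure.isProbabilityMeasure_map hγm.aemeasurable
  have : IsProbabilityMeasure (proj γ P) := Measure.isProbabilityMeasure_map hγm.aemeasurable
  -- Ending the interval at the maximum of the functional on the support gives length exactly `D`;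
  -- centring it at a point of the support would give `2 D`.
  obtain ⟨x₁, hx₁, hmax⟩ := hP.exists_isMaxOn
    (Measure.nonempty_support (IsProbabilityMeasure.ne_zero P)) hγc.continuousOn
  have hmem : ∀ x ∈ P.support, x ⬝ᵥ γ ∈ Set.Icc (x₁ ⬝ᵥ γ - D) (x₁ ⬝ᵥ γ) := fun x hx => by
    have h := hosc γ hγ x₁ hx₁ x hx
    rw [sub_dotProduct] at h
    exact ⟨by linarith, hmax hx⟩
  have hproj : ∀ Q : Measure (Fin m → ℝ), (∀ᵐ x ∂Q, x ∈ P.support) →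
      ∀ᵐ t ∂(proj γ Q), t ∈ Set.Icc (x₁ ⬝ᵥ γ - D) (x₁ ⬝ᵥ γ) := fun Q hQ =>
    (ae_map_iff hγm.aemeasurable (p := fun t => t ∈ Set.Icc (x₁ ⬝ᵥ γ - D) (x₁ ⬝ᵥ γ))
      measurableSet_Icc).2 (hQ.mono hmem)
  have hemp : ∀ᵐ x ∂(empirical z), x ∈ P.support := by
    refine Measure.ae_smul_measure ?_ _
    rw [ae_iff, Measure.finsetSum_apply]
    refine Finset.sum_eq_zero fun k _ => ?_
    simp [Measure.dirac_apply, hz k]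
  have h3 := wasserstein_rpow_le (sub_le_self _ hD) hr (hproj _ hemp)
    (hproj P Measure.support_mem_ae) (K := K) (fun h hh => by
    rw [proj, proj, integral_map hγm.aemeasurable hh.continuous.aestronglyMeasurable,
      integral_map hγm.aemeasurable hh.continuous.aestronglyMeasurable, integral_empirical]
    exact hK γ hγ h hh)
  rwa [sub_sub_cancel] at h3

/-- Constants do not change the deviation, so test functions may be pinned at a point. -/
lemma empiricalDeviation_sub_const {X : Type*} [MeasurableSpace X] {n : ℕ} (hn : 1 ≤ n)
    {P : Measure X} [IsProbabilityMeasure P] (z : Fin n → X) {g : X → ℝ} (c : ℝ)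
    (hg : Integrable (fun x => g x - c) P) :
    empiricalDeviation P z g = empiricalDeviation P z fun x => g x - c := by
  have hn' : (n : ℝ) ≠ 0 := by exact_mod_cast (by omega : n ≠ 0)
  have hg' : Integrable g P := (hg.add (integrable_const c)).congr <|
    Filter.Eventually.of_forall fun x => by simp
  simp only [empiricalDeviation]
  rw [integral_sub hg' (integrable_const c), Finset.sum_sub_distrib]
  simp
  field_simp
  ring

theorem theorem2 (d n : ℕ) (hn : 1 ≤ n)
    (N : Seminorm ℝ (Fin (d + 1) → ℝ)) (hN : ∀ x, N x = 0 → x = 0)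
    (r : ℝ) (hr : 1 ≤ r)
    (P : Measure (Fin (d + 1) → ℝ)) [IsProbabilityMeasure P] (hP : IsCompact P.support)
    {Ω : Type*} [MeasurableSpace Ω] (μ : Measure Ω) [IsProbabilityMeasure μ]
    (Z : Fin n → Ω → (Fin (d + 1) → ℝ))
    (hlaw : ∀ i, HasLaw (Z i) P μ) (hindep : iIndepFun Z μ)
    (α : ℝ) (hα0 : 0 < α) (hα1 : α ≤ 1) :
    ∃ E : Set Ω, MeasurableSet E ∧ ENNReal.ofReal (1 - α) ≤ μ E ∧
      ∀ ω ∈ E,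
        maxSlicedWasserstein N r (empirical fun i => Z i ω) P ^ r ≤
          ENNReal.ofReal
            ((180 * Real.sqrt ((d : ℝ) + 2) + Real.sqrt (2 * Real.log (1 / α))) *
              dualDiam N P.support ^ r / Real.sqrt n) := by
  set S := P.support with hSdef
  set D := dualDiam N S with hDdef
  have hS : ∀ᵐ x ∂P, x ∈ S := Measure.support_mem_ae
  obtain ⟨x₀, hx₀⟩ : S.Nonempty := Measure.nonempty_support (IsProbabilityMeasure.ne_zero P)
  have hD0 : 0 ≤ D := dualDiam_nonneg hN hP.isBounded ⟨x₀, hx₀⟩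
  have habs : ∀ γ, ∀ x ∈ S, ∀ y ∈ S, |(x - y) ⬝ᵥ γ| ≤ N γ * D := fun γ x hx y hy =>
    abs_dotProduct_sub_le hN hP.isBounded γ hx hy
  have hosc : ∀ γ, N γ = 1 → ∀ x ∈ S, ∀ y ∈ S, (x - y) ⬝ᵥ γ ≤ D := fun γ hγ x hx y hy => by
    have := (le_abs_self _).trans (habs γ x hx y hy)
    rwa [hγ, one_mul] at this
  have hdot : ∀ γ : Fin (d + 1) → ℝ, Continuous fun x : Fin (d + 1) → ℝ => x ⬝ᵥ γ := fun γ => by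
    unfold dotProduct; fun_prop
  have hn' : (0 : ℝ) < √n := Real.sqrt_pos.2 (by exact_mod_cast hn)
  set B := √(2 * Real.log (1 / α)) with hB
  rcases hD0.eq_or_lt with hD | hD
  -- When `D = 0` the chaining bound is unavailable, but every ridge function is constant on the
  -- support. Empty families leave only the event that the sample lies in the support.
  · obtain ⟨E, hE1, hE2, hE3⟩ := exists_event_empiricalDeviation_le hn hlaw hindep hS
      (G := fun _ => ∅) (A := fun _ => 0) (σ := fun _ => 1) (fun _ => Set.finite_empty)
      (fun _ => le_rfl) (fun _ => by simp) (fun _ => one_pos) (by simp) (by simp) hα0 hα1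
    refine ⟨E, hE1, hE2, fun ω hω => ?_⟩
    have hz := (hE3 ω hω).1
    -- The zero has to come from `K`, since `D ^ (r - 1)` is 1 when `r = 1`.
    refine (maxSlicedWasserstein_empirical_rpow_le hn hr hP hz hD0 hosc (K := 0) ?_).trans
      (by simp)
    intro γ hγ h hh
    have hzero : ∀ x ∈ S, |h (x ⬝ᵥ γ) - h (x₀ ⬝ᵥ γ)| ≤ 0 := fun x hx => by
      refine (hh.abs_sub_le_abs_sub _ _).trans ?_
      rw [← sub_dotProduct]
      simpa [← hD] using habs γ x hx x₀ hx₀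
    have hm : Measurable fun x : Fin (d + 1) → ℝ => h (x ⬝ᵥ γ) - h (x₀ ⬝ᵥ γ) :=
      ((hh.continuous.comp (hdot γ)).sub continuous_const).measurable
    rw [empiricalDeviation_sub_const hn _ _ (integrable_of_abs_le_on hS hm hzero)]
    simpa using empiricalDeviation_le_two_mul hn hS hz hzero
  · let f : {γ // N γ ≤ 1} × PinnedLipschitz (-D) → (Fin (d + 1) → ℝ) → ℝ :=
      fun p x => p.2.1 ((x - x₀) ⬝ᵥ p.1.1)
    have : Nonempty ({γ // N γ ≤ 1} × PinnedLipschitz (-D)) :=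
      ⟨⟨0, by simp⟩, ⟨fun _ => 0, LipschitzWith.const' 0, rfl⟩⟩
    have hf : ∀ p, Measurable (f p) := fun p =>
      (p.2.2.1.continuous.comp ((hdot p.1.1).comp (continuous_id.sub continuous_const))).measurable
    have hfosc : ∀ p, ∀ x ∈ S, ∀ y ∈ S, |f p x - f p y| ≤ D := fun p x hx y hy => by
      refine (p.2.2.1.abs_sub_le_abs_sub _ _).trans ?_
      rw [← sub_dotProduct, sub_sub_sub_cancel_right]
      exact (habs _ x hx y hy).trans (mul_le_of_le_one_left hD0 p.1.2)
    obtain ⟨E, hE1, hE2, hE3⟩ := exists_event_forall_empiricalDeviation_le hn hlaw hindep hS hf hD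
      (a := d + 2) (by linarith [(Nat.cast_nonneg d : (0 : ℝ) ≤ d)])
      (fun p x hx y hy => (le_abs_self _).trans (hfosc p x hx y hy))
      (exists_code_ridge N hN hD S x₀ fun γ x hx => habs γ x hx x₀ hx₀) hα0 hα1
    refine ⟨E, hE1, hE2, fun ω hω => ?_⟩
    obtain ⟨hz, hdev⟩ := hE3 ω hω
    refine (maxSlicedWasserstein_empirical_rpow_le hn hr hP hz hD0 hosc
      (K := D * (24 * √((d : ℝ) + 2) + B) / √n) ?_).trans (ENNReal.ofReal_le_ofReal ?_)
    · intro γ hγ h hh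
      -- In the coordinate centred at `x₀` the projections lie in `[-D, D]`; subtracting `c` pins
      -- the translate of `h` at the left end.
      let c := h (-D + x₀ ⬝ᵥ γ)
      let p : {γ // N γ ≤ 1} × PinnedLipschitz (-D) :=
        ⟨⟨γ, hγ.le⟩, ⟨fun t => h (t + x₀ ⬝ᵥ γ) - c, by
          refine LipschitzWith.of_dist_le_mul fun s t => ?_
          have := hh.abs_sub_le_abs_sub (s + x₀ ⬝ᵥ γ) (t + x₀ ⬝ᵥ γ)
          simpa [Real.dist_eq] using this, sub_self _⟩⟩
      have hp : (fun x => h (x ⬝ᵥ γ) - c) = f p := by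
        ext x
        simp [f, p, sub_dotProduct]
      have hint : Integrable (f p) P := by
        refine integrable_of_abs_le_on hS (hf p) (e := |f p x₀| + D) fun x hx => ?_
        have h1 := abs_le.1 (hfosc p x hx x₀ hx₀)
        rw [abs_le]
        constructor <;> linarith [neg_abs_le (f p x₀), le_abs_self (f p x₀), h1.1, h1.2]
      rw [empiricalDeviation_sub_const hn _ c (by rw [hp]; exact hint), hp]
      exact hdev p
    · have e : D ^ r = D ^ (r - 1) * D := by
        rw [← Real.rpow_add_one' hD0 (by linarith)]
        congr 1
        ring
      rw [e]
      have hDr : 0 ≤ D ^ (r - 1) * D := mul_nonneg (Real.rpow_nonneg hD0 _) hD0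
      calc D ^ (r - 1) * (D * (24 * √((d : ℝ) + 2) + B) / √n)
          = (24 * √((d : ℝ) + 2) + B) * (D ^ (r - 1) * D) / √n := by ring
        -- The chaining constant 24 is below the stated 180.
        _ ≤ (180 * √((d : ℝ) + 2) + B) * (D ^ (r - 1) * D) / √n := by
          refine div_le_div_of_nonneg_right (mul_le_mul_of_nonneg_right ?_ hDr) hn'.le
          linarith [Real.sqrt_nonneg ((d : ℝ) + 2)]
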